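/- Let $\mathcal H$ be a separable complex Hilbert space. Let $\widehat{\mathbb{SF}}_*(\mathcal H)$ be the set of bounded self-adjoint Fredholm operators $F$ on $\mathcal H$ with $\|F\|=1$ and essential spectrum $\sigma_{\rm ess}(F)=\{-1,1\}$, and let $$\mathbb P(\mathcal H)=\{(F,U)\;:\;F\in\widehat{\mathbb{SF}}_*(\mathcal H),\ U \text{ unitary on }\mathcal H,\ [F,U]\text{ compact}\},$$ with the subspace topology of the norm topology. For $(F,U)\in\mathbb P(\mathcal H)$ let $\Theta(F,U)$ be the set of norm continuous paths $s\in[0,1]\mapsto F_s\in\widehat{\mathbb{SF}}_*(\mathcal H)$ with $F_0=F$, $F_1=U^*FU$ and $F_s-F$ compact for all $s$. The spectral flow of such a path is $$\mathrm{SF}(s\mapsto F_s)=\sum_{n=1}^N\mathrm{Tr}\big(\chi_{(a_n,0]}(F_{s_{n-1}})-\chi_{(a_n,0]}(F_{s_n})\big),$$ where $0=s_0<s_1<\dots<s_N=1$ and $-1<a_n<0<b_n<1$ are chosen such that on each $[s_{n-1},s_n]$ the map $s\mapsto\chi_{(a_n,b_n]}(F_s)$ is norm continuous with constant finite rank. Then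 $\mathrm{SF}$ is a well-defined map $\mathbb P(\mathcal H)\to\mathbb Z$: for every $(F,U)\in\mathbb P(\mathcal H)$ the set $\Theta(F,U)$ is non-empty, every path in it admits such choices, and the resulting integer, denoted $\mathrm{SF}(F,U)$, depends neither on these choices nor on the path in $\Theta(F,U)$. Moreover, the map $\mathrm{SF}:\mathbb P(\mathcal H)\to\mathbb Z$ is locally constant. -/

import Mathlib

open scoped unitInterval

noncomputable section

namespace PairFlow

variable {H : Type*} [NormedAddCommGroup H] [InnerProductSpace ℂ H] [CompleteSpace H]

/-- The essential spectrum of `T`: all `z` for which `T - z` is not Fredholm. -/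
def essentialSpectrum (T : H →L[ℂ] H) : Set ℂ :=
  {z | ¬ (T - z • (1 : H →L[ℂ] H)).IsFredholm}

variable (H) in
/-- Self-adjoint Fredholm operators having both positive and negative essential spectrum. -/
def SFStar : Set (H →L[ℂ] H) :=
  {F | IsSelfAdjoint F ∧ F.IsFredholm ∧
    (∃ x : ℝ, 0 < x ∧ (x : ℂ) ∈ essentialSpectrum F) ∧
    (∃ x : ℝ, x < 0 ∧ (x : ℂ) ∈ essentialSpectrum F)}

variable (H) in
/-- The operators in `SFStar H` of norm `1` whose essential spectrum is `{-1, 1}`. -/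
def SFHat : Set (H →L[ℂ] H) :=
  {F | F ∈ SFStar H ∧ ‖F‖ = 1 ∧ essentialSpectrum F = {-1, 1}}

variable (H) in
/-- The space `P(H)` of pairs `(F, U)`, with the subspace topology of the norm topology. -/
def Pairs : Set ((H →L[ℂ] H) × (H →L[ℂ] H)) :=
  {p | p.1 ∈ SFHat H ∧ p.2 ∈ unitary (H →L[ℂ] H) ∧ IsCompactOperator (p.1 * p.2 - p.2 * p.1)}

/-- The spectral projection `χ_{(-∞, t]}(F)` of a self-adjoint operator `F`: the orthogonal
projection onto the kernel of `(F - t)₊`, the function `x ↦ max (x - t) 0` vanishing exactly on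
`(-∞, t]`. -/
def spectralProjIic (F : H →L[ℂ] H) (t : ℝ) : H →L[ℂ] H :=
  ((cfc (fun x : ℝ => max (x - t) 0) F).ker).starProjection

/-- The spectral projection `χ_{(a, b]}(F)` of a self-adjoint operator `F`, for `a ≤ b`. -/
def spectralProj (a b : ℝ) (F : H →L[ℂ] H) : H →L[ℂ] H :=
  spectralProjIic F b - spectralProjIic F a

/-- `HasSpectralFlow γ m`: some partition `0 = t₀ < ⋯ < t_N = 1` and levels `aₙ < 0 < bₙ` in
`(-1, 1)`, such that `s ↦ χ_{(aₙ, bₙ]}(γ s)` is norm continuous with constant finite rank on the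
`n`-th subinterval, compute the spectral flow `m` of the path `γ`, that is
`m = ∑ₙ (Tr χ_{(aₙ, 0]}(γ tₙ₋₁) - Tr χ_{(aₙ, 0]}(γ tₙ))`. The traces are those of finite rank
orthogonal projections, that is, their ranks. -/
def HasSpectralFlow (γ : C(I, H →L[ℂ] H)) (m : ℤ) : Prop :=
  ∃ (N : ℕ) (t : Fin (N + 1) → I) (a b : Fin N → ℝ),
    StrictMono t ∧ t 0 = 0 ∧ t (Fin.last N) = 1 ∧
    (∀ n, -1 < a n ∧ a n < 0 ∧ 0 < b n ∧ b n < 1) ∧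
    (∀ n, ContinuousOn (fun s => spectralProj (a n) (b n) (γ s))
      (Set.Icc (t n.castSucc) (t n.succ))) ∧
    (∀ n, ∃ r : ℕ, ∀ s ∈ Set.Icc (t n.castSucc) (t n.succ),
      FiniteDimensional ℂ (spectralProj (a n) (b n) (γ s)).range ∧
      Module.finrank ℂ (spectralProj (a n) (b n) (γ s)).range = r) ∧
    m = ∑ n, ((Module.finrank ℂ (spectralProj (a n) 0 (γ (t n.castSucc))).range : ℤ) -
      (Module.finrank ℂ (spectralProj (a n) 0 (γ (t n.succ))).range : ℤ))

/-- The set `Θ(F, U)` of norm continuous paths in `SFHat H` from `F` to `U* F U` by compact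
perturbations of `F`. -/
def Theta (F U : H →L[ℂ] H) : Set C(I, H →L[ℂ] H) :=
  {γ | (∀ s, γ s ∈ SFHat H) ∧ γ 0 = F ∧ (∀ s, IsCompactOperator (γ s - F)) ∧
    γ 1 = star U * F * U}

open Classical in
/-- The spectral flow `SF(F, U)` of a pair: the common value of the spectral flow on `Θ(F, U)`
(and `0` if there were no such value). -/
def SF (p : Pairs H) : ℤ :=
  if h : ∃ m : ℤ, ∀ γ ∈ Theta p.1.1 p.1.2, HasSpectralFlow γ m then h.choose else 0

end PairFlow

end

noncomputable section

namespace PairFlow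

section Fredholm

set_option linter.unusedSectionVars false

open LinearMap.FiniteRangeSetoid

variable {E F G : Type*}
  [NormedAddCommGroup E] [InnerProductSpace ℂ E]
  [NormedAddCommGroup F] [InnerProductSpace ℂ F]
  [NormedAddCommGroup G] [InnerProductSpace ℂ G]

/-- The continuous linear map `T` is a compact operator. -/
def IsCompactCLM (T : E →L[ℂ] F) : Prop := IsCompactOperator (fun x => T x)

namespace IsCompactCLM

variable {S T : E →L[ℂ] F}

theorem zero : IsCompactCLM (0 : E →L[ℂ] F) := isCompactOperator_zero

theorem add (hS : IsCompactCLM S) (hT : IsCompactCLM T) : IsCompactCLM (S + T) :=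
  IsCompactOperator.add hS hT

theorem sub (hS : IsCompactCLM S) (hT : IsCompactCLM T) : IsCompactCLM (S - T) :=
  IsCompactOperator.sub hS hT

theorem neg (hS : IsCompactCLM S) : IsCompactCLM (-S) := IsCompactOperator.neg hS

theorem smul (hS : IsCompactCLM S) (c : ℂ) : IsCompactCLM (c • S) := IsCompactOperator.smul hS c

theorem clm_comp (hS : IsCompactCLM S) (A : F →L[ℂ] G) : IsCompactCLM (A ∘L S) :=
  IsCompactOperator.clm_comp hS A

theorem comp_clm (hS : IsCompactCLM S) (A : G →L[ℂ] E) : IsCompactCLM (S ∘L A) :=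
  IsCompactOperator.comp_clm hS A

theorem mul_left {S : E →L[ℂ] E} (hS : IsCompactCLM S) (A : E →L[ℂ] E) : IsCompactCLM (A * S) :=
  hS.clm_comp A

theorem mul_right {S : E →L[ℂ] E} (hS : IsCompactCLM S) (A : E →L[ℂ] E) : IsCompactCLM (S * A) :=
  hS.comp_clm A

theorem of_hasFiniteRange (h : T.toLinearMap.HasFiniteRange) : IsCompactCLM T := by
  have : FiniteDimensional ℂ T.range := (Submodule.fg_iff_finiteDimensional _).1 h
  have : ProperSpace T.range := FiniteDimensional.proper ℂ _
  exact (isCompactOperator_of_locallyCompactSpace_dom T.rangeRestrict).clm_comp T.range.subtypeL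

end IsCompactCLM

/-- A compact operator into a Hilbert space is a norm limit of operators of finite rank. -/
theorem exists_hasFiniteRange_norm_sub_lt {K : E →L[ℂ] F} (hK : IsCompactCLM K) {ε : ℝ}
    (hε : 0 < ε) : ∃ T : E →L[ℂ] F, T.toLinearMap.HasFiniteRange ∧ ‖K - T‖ < ε := by
  obtain ⟨C, hC, hKC⟩ := IsCompactOperator.image_closedBall_subset_compact
    (f := K.toLinearMap) (show IsCompactOperator K from hK) 1
  obtain ⟨t, -, ht, hCt⟩ := hC.finite_cover_balls (half_pos hε)
  have : FiniteDimensional ℂ (Submodule.span ℂ t) := FiniteDimensional.span_of_finite ℂ ht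
  set S := Submodule.span ℂ t
  refine ⟨S.starProjection ∘L K, ?_, ?_⟩
  · have h : S.starProjection.toLinearMap.HasFiniteRange := by
      rw [LinearMap.HasFiniteRange, Submodule.range_starProjection, Submodule.fg_iff_finiteDimensional]
      exact this
    exact h.comp_right _
  · refine lt_of_le_of_lt (ContinuousLinearMap.opNorm_le_of_unit_norm (C := ε / 2)
      (by positivity) fun x hx => ?_) (half_lt_self hε)
    have h1 : K x ∈ C := hKC ⟨x, by simp [hx], rfl⟩
    obtain ⟨c, hc, hxc⟩ := Set.mem_iUnion₂.1 (hCt h1)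
    have h3 : ‖K x - S.starProjection (K x)‖ ≤ ‖K x - c‖ := by
      rw [Submodule.starProjection_minimal (U := S) (K x)]
      exact ciInf_le ⟨0, by rintro _ ⟨y, rfl⟩; positivity⟩
        (⟨c, Submodule.subset_span hc⟩ : S)
    rw [← dist_eq_norm (K x) c] at h3
    exact h3.trans (Metric.mem_ball.1 hxc).le

theorem exists_unit_sub_hasFiniteRange [CompleteSpace E] {T : E →L[ℂ] E}
    (hT : IsCompactCLM (T - 1)) :
    ∃ u : (E →L[ℂ] E)ˣ, T.toLinearMap ≈ (u : E →L[ℂ] E).toLinearMap := by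
  obtain ⟨R, hR, hKR⟩ := exists_hasFiniteRange_norm_sub_lt hT one_pos
  refine ⟨Units.oneSub (-(T - 1 - R)) (by rwa [norm_neg]), ?_⟩
  rw [equiv_iff_hasFiniteRange]
  have : T.toLinearMap - (Units.oneSub (-(T - 1 - R)) (by rwa [norm_neg]) :
      E →L[ℂ] E).toLinearMap = R.toLinearMap := by
    ext x
    simp only [Units.val_oneSub, LinearMap.sub_apply, ContinuousLinearMap.coe_coe,
      sub_apply, neg_apply, one_apply_eq_self]
    abel
  rwa [this]

variable [CompleteSpace E] [CompleteSpace F]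

/-- Operators invertible modulo compact operators are Fredholm. -/
theorem isFredholm_of_isCompactCLM_comp_sub_one {T : E →L[ℂ] F} {S : F →L[ℂ] E}
    (h1 : IsCompactCLM (S ∘L T - 1)) (h2 : IsCompactCLM (T ∘L S - 1)) :
    T.IsFredholm := by
  obtain ⟨u, hu⟩ := exists_unit_sub_hasFiniteRange h1
  obtain ⟨v, hv⟩ := exists_unit_sub_hasFiniteRange h2
  have hl : ((↑u⁻¹ : E →L[ℂ] E) ∘L S).toLinearMap ∘ₗ T.toLinearMap ≈ LinearMap.id := by
    have h := equiv_comp_left (u' := (↑u⁻¹ : E →L[ℂ] E).toLinearMap) hu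
    have e : (↑u⁻¹ : E →L[ℂ] E).toLinearMap ∘ₗ (u : E →L[ℂ] E).toLinearMap = LinearMap.id := by
      ext x; exact DFunLike.congr_fun u.inv_mul x
    rw [e] at h
    exact h
  have hr : T.toLinearMap ∘ₗ (S ∘L (↑v⁻¹ : F →L[ℂ] F)).toLinearMap ≈ LinearMap.id := by
    have h := equiv_comp_right (u := (↑v⁻¹ : F →L[ℂ] F).toLinearMap) hv
    have e : (v : F →L[ℂ] F).toLinearMap ∘ₗ (↑v⁻¹ : F →L[ℂ] F).toLinearMap = LinearMap.id := by
      ext x; exact DFunLike.congr_fun v.mul_inv x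
    rw [e] at h
    exact h
  refine ContinuousLinearMap.IsFredholm.of_isQuasiInverse
    (v := (↑u⁻¹ : E →L[ℂ] E) ∘L S) ⟨hl, ?_⟩
  set L := ((↑u⁻¹ : E →L[ℂ] E) ∘L S).toLinearMap
  set R := (S ∘L (↑v⁻¹ : F →L[ℂ] F)).toLinearMap
  have hLR : L ≈ R := by
    have h3 : L ∘ₗ (T.toLinearMap ∘ₗ R) ≈ L := by simpa using equiv_comp_left (u' := L) hr
    have h4 : (L ∘ₗ T.toLinearMap) ∘ₗ R ≈ R := by simpa using equiv_comp_right (u := R) hl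
    exact Setoid.trans (Setoid.symm h3) h4
  exact Setoid.trans (equiv_comp_left hLR) hr

/-- A Fredholm operator has a Fredholm inverse modulo compact operators. -/
theorem exists_isCompactCLM_comp_sub_one {T : E →L[ℂ] F} (hT : T.IsFredholm) :
    ∃ S : F →L[ℂ] E, S.IsFredholm ∧ IsCompactCLM (S ∘L T - 1) ∧ IsCompactCLM (T ∘L S - 1) := by
  obtain ⟨S, hS1, hS2⟩ := hT.exists_isQuasiInverse
  refine ⟨S, .of_isQuasiInverse (v := T) ⟨hS2, hS1⟩, .of_hasFiniteRange ?_, .of_hasFiniteRange ?_⟩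
  · exact equiv_iff_hasFiniteRange.1 hS1
  · exact equiv_iff_hasFiniteRange.1 hS2

theorem IsCompactCLM.comp_add_sub_one {T T' : E →L[ℂ] F} {S : F →L[ℂ] E}
    (hS : IsCompactCLM (S ∘L T - 1)) (h : IsCompactCLM (T' - T)) :
    IsCompactCLM (S ∘L T' - 1) := by
  have e : S ∘L T' - 1 = (S ∘L T - 1) + S ∘L (T' - T) := by
    ext x; simp
  rw [e]
  exact hS.add (h.clm_comp S)

/-- The Fredholm property is stable under compact perturbations. -/
theorem isFredholm_of_isCompactCLM_sub {T T' : E →L[ℂ] F} (hT : T.IsFredholm)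
    (h : IsCompactCLM (T' - T)) : T'.IsFredholm := by
  obtain ⟨S, -, hS1, hS2⟩ := exists_isCompactCLM_comp_sub_one hT
  refine isFredholm_of_isCompactCLM_comp_sub_one (hS1.comp_add_sub_one h) ?_
  have e : T' ∘L S - 1 = (T ∘L S - 1) + (T' - T) ∘L S := by
    ext x; simp
  rw [e]
  exact hS2.add (h.comp_clm S)

theorem isFredholm_of_bijective {T : E →L[ℂ] F} (h : Function.Bijective T) : T.IsFredholm := by
  set e := ContinuousLinearEquiv.ofBijective T (LinearMap.ker_eq_bot.2 h.1)
    (LinearMap.range_eq_top.2 h.2) with he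
  refine isFredholm_of_isCompactCLM_comp_sub_one (S := (e.symm : F →L[ℂ] E)) ?_ ?_
  · convert IsCompactCLM.zero
    ext x
    have : e.symm (T x) = x := e.symm_apply_apply x
    simp [this]
  · convert IsCompactCLM.zero
    ext x
    have : T (e.symm x) = x := e.apply_symm_apply x
    simp [this]

theorem isFredholm_of_isUnit {T : E →L[ℂ] E} (hT : IsUnit T) : T.IsFredholm :=
  isFredholm_of_bijective (ContinuousLinearMap.isUnit_iff_bijective.1 hT)

theorem isFredholm_comp [CompleteSpace G] {T : E →L[ℂ] F} {S : F →L[ℂ] G} (hT : T.IsFredholm)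
    (hS : S.IsFredholm) : (S ∘L T).IsFredholm := by
  obtain ⟨T', hT'⟩ := hT.exists_isQuasiInverse
  obtain ⟨S', hS'⟩ := hS.exists_isQuasiInverse
  exact .of_isQuasiInverse (v := T' ∘L S') (hT'.comp hS')

/-- The Fredholm index. -/
def fredholmIndex (T : E →L[ℂ] F) : ℤ := T.toLinearMap.index

theorem fredholmIndex_comp [CompleteSpace G] {T : E →L[ℂ] F} {S : F →L[ℂ] G} (hT : T.IsFredholm)
    (hS : S.IsFredholm) : fredholmIndex (S ∘L T) = fredholmIndex S + fredholmIndex T := by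
  have := hT.finite_ker
  have := hS.finite_ker
  have : FiniteDimensional ℂ (F ⧸ T.range) := hT.finite_coker
  have : FiniteDimensional ℂ (G ⧸ S.range) := hS.finite_coker
  exact LinearMap.index_comp S.toLinearMap

theorem fredholmIndex_of_bijective {T : E →L[ℂ] F} (hT : Function.Bijective T) :
    fredholmIndex T = 0 :=
  LinearEquiv.index_eq_zero (e := LinearEquiv.ofBijective T.toLinearMap hT)

theorem fredholmIndex_unit (u : (E →L[ℂ] E)ˣ) : fredholmIndex (u : E →L[ℂ] E) = 0 :=
  fredholmIndex_of_bijective (ContinuousLinearMap.isUnit_iff_bijective.1 u.isUnit)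

/-- The index is invariant under finite rank perturbations. -/
theorem fredholmIndex_eq_of_equiv {T S : E →L[ℂ] F} (hT : T.IsFredholm) (hS : S.IsFredholm)
    (h : T.toLinearMap ≈ S.toLinearMap) : fredholmIndex T = fredholmIndex S := by
  have hX : (T.toLinearMap - S.toLinearMap).ker.CoFG :=
    LinearMap.ker_coFG_iff_hasFiniteRange.2 (equiv_iff_hasFiniteRange.1 h)
  set X := (T.toLinearMap - S.toLinearMap).ker
  have := hT.finite_ker
  have := hS.finite_ker
  have : FiniteDimensional ℂ (F ⧸ T.range) := hT.finite_coker
  have : FiniteDimensional ℂ (F ⧸ S.range) := hS.finite_coker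
  have : FiniteDimensional ℂ (E ⧸ X.subtype.range) := by rwa [Submodule.range_subtype]
  have : FiniteDimensional ℂ X.subtype.ker := by rw [Submodule.ker_subtype]; infer_instance
  have h1 := LinearMap.index_comp (f := X.subtype) T.toLinearMap
  have h2 := LinearMap.index_comp (f := X.subtype) S.toLinearMap
  have e : T.toLinearMap ∘ₗ X.subtype = S.toLinearMap ∘ₗ X.subtype := by
    ext x
    exact sub_eq_zero.1 x.2
  rw [e, h2] at h1
  exact (add_right_cancel h1).symm

theorem fredholmIndex_of_isCompactCLM_sub_one {T : E →L[ℂ] E} (hT : IsCompactCLM (T - 1)) :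
    fredholmIndex T = 0 := by
  obtain ⟨u, hu⟩ := exists_unit_sub_hasFiniteRange hT
  rw [fredholmIndex_eq_of_equiv (isFredholm_of_isCompactCLM_sub (isFredholm_of_isUnit isUnit_one) hT)
    (isFredholm_of_isUnit u.isUnit) hu, fredholmIndex_unit]

/-- The index is invariant under compact perturbations. -/
theorem fredholmIndex_eq_of_isCompactCLM_sub {T T' : E →L[ℂ] F} (hT : T.IsFredholm)
    (h : IsCompactCLM (T' - T)) : fredholmIndex T' = fredholmIndex T := by
  obtain ⟨S, hSF, hS1, hS2⟩ := exists_isCompactCLM_comp_sub_one hT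
  have h1 := fredholmIndex_of_isCompactCLM_sub_one hS1
  have h2 := fredholmIndex_of_isCompactCLM_sub_one (hS1.comp_add_sub_one h)
  rw [fredholmIndex_comp hT hSF] at h1
  rw [fredholmIndex_comp (isFredholm_of_isCompactCLM_sub hT h) hSF] at h2
  linarith

end Fredholm

section RelativeIndex

set_option linter.unusedSectionVars false

variable {H : Type*} [NormedAddCommGroup H] [InnerProductSpace ℂ H] [CompleteSpace H]
variable (U V W X : Submodule ℂ H) [CompleteSpace U] [CompleteSpace V] [CompleteSpace W]
  [CompleteSpace X]

/-- The orthogonal projection onto `W`, restricted to `V`. -/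
def compareMap : V →L[ℂ] W := W.orthogonalProjectionOnto ∘L V.subtypeL

/-- The relative index of two closed subspaces whose projections differ by a compact operator. -/
def relIndex : ℤ := fredholmIndex (compareMap V W)

variable {U V W X}

theorem compareMap_comp_sub_one : compareMap W V ∘L compareMap V W - 1 =
    V.orthogonalProjectionOnto ∘L (W.starProjection - V.starProjection) ∘L V.subtypeL := by
  ext x
  simp [compareMap]

theorem isFredholm_compareMap (h : IsCompactCLM (V.starProjection - W.starProjection)) :
    (compareMap V W).IsFredholm := by
  refine isFredholm_of_isCompactCLM_comp_sub_one (S := compareMap W V) ?_ ?_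
  · rw [compareMap_comp_sub_one]
    rw [← neg_sub] at h
    simpa using (h.neg.comp_clm V.subtypeL).clm_comp V.orthogonalProjectionOnto
  · rw [compareMap_comp_sub_one]
    exact (h.comp_clm W.subtypeL).clm_comp W.orthogonalProjectionOnto

theorem relIndex_add (h : IsCompactCLM (V.starProjection - W.starProjection))
    (h' : IsCompactCLM (W.starProjection - X.starProjection)) :
    relIndex V W + relIndex W X = relIndex V X := by
  have hVX : IsCompactCLM (V.starProjection - X.starProjection) := by
    simpa using h.add h'
  unfold relIndex
  rw [add_comm, ← fredholmIndex_comp (isFredholm_compareMap h) (isFredholm_compareMap h')]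
  refine fredholmIndex_eq_of_isCompactCLM_sub (isFredholm_compareMap hVX) ?_
  have e : compareMap W X ∘L compareMap V W - compareMap V X =
      -(X.orthogonalProjectionOnto ∘L (V.starProjection - W.starProjection) ∘L V.subtypeL) := by
    ext x
    simp [compareMap]
  rw [e]
  exact ((h.comp_clm _).clm_comp _).neg

theorem bijective_compareMap_comp (h : ‖V.starProjection - W.starProjection‖ < 1) :
    Function.Bijective (compareMap W V ∘L compareMap V W) := by
  rw [← ContinuousLinearMap.isUnit_iff_bijective]
  set T := compareMap W V ∘L compareMap V W with hT
  have h1 : ‖1 - T‖ < 1 := by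
    refine (norm_sub_rev 1 T).trans_lt (lt_of_le_of_lt ?_ h)
    rw [hT, compareMap_comp_sub_one]
    calc _ ≤ ‖V.orthogonalProjectionOnto‖ * (‖W.starProjection - V.starProjection‖ *
          ‖V.subtypeL‖) :=
        (ContinuousLinearMap.opNorm_comp_le _ _).trans
          (mul_le_mul_of_nonneg_left (ContinuousLinearMap.opNorm_comp_le _ _) (norm_nonneg _))
      _ ≤ 1 * (‖W.starProjection - V.starProjection‖ * 1) := by
        gcongr
        · exact V.orthogonalProjectionOnto_norm_le
        · exact V.norm_subtypeL_le
      _ = _ := by rw [one_mul, mul_one, norm_sub_rev]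
  simpa using (Units.oneSub (1 - T) h1).isUnit

theorem bijective_compareMap (h : ‖V.starProjection - W.starProjection‖ < 1) :
    Function.Bijective (compareMap V W) := by
  have h1 := bijective_compareMap_comp h
  rw [norm_sub_rev] at h
  have h2 := bijective_compareMap_comp h
  rw [ContinuousLinearMap.coe_comp] at h1 h2
  exact ⟨Function.Injective.of_comp h1.1, Function.Surjective.of_comp h2.2⟩

theorem relIndex_of_norm_sub_lt (h : ‖V.starProjection - W.starProjection‖ < 1) :
    relIndex V W = 0 :=
  fredholmIndex_of_bijective (bijective_compareMap h)

theorem relIndex_self : relIndex V V = 0 :=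
  relIndex_of_norm_sub_lt (by simp)

theorem relIndex_swap (h : IsCompactCLM (V.starProjection - W.starProjection)) :
    relIndex W V = - relIndex V W := by
  have h' : IsCompactCLM (W.starProjection - V.starProjection) := by simpa using h.neg
  have := relIndex_add h h'
  rw [relIndex_self] at this
  linarith

/-- The relative index is locally constant. -/
theorem relIndex_eq_of_norm_sub_lt (h : IsCompactCLM (U.starProjection - V.starProjection))
    (h' : IsCompactCLM (W.starProjection - X.starProjection))
    (h₁ : ‖U.starProjection - W.starProjection‖ < 1)
    (h₂ : ‖V.starProjection - X.starProjection‖ < 1) : relIndex U V = relIndex W X := by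
  have b₁ := bijective_compareMap h₁
  have b₂ := bijective_compareMap h₂
  have e1 := fredholmIndex_comp (isFredholm_compareMap h) (isFredholm_of_bijective b₂)
  have e2 := fredholmIndex_comp (isFredholm_of_bijective b₁) (isFredholm_compareMap h')
  rw [fredholmIndex_of_bijective b₂, zero_add] at e1
  rw [fredholmIndex_of_bijective b₁, add_zero] at e2
  unfold relIndex
  rw [← e1, ← e2]
  refine fredholmIndex_eq_of_isCompactCLM_sub
    (isFredholm_comp (isFredholm_of_bijective b₁) (isFredholm_compareMap h')) ?_
  have e : compareMap V X ∘L compareMap U V - compareMap W X ∘L compareMap U W =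
      -(X.orthogonalProjectionOnto ∘L (U.starProjection - V.starProjection) ∘L U.subtypeL) -
      (X.orthogonalProjectionOnto ∘L (W.starProjection - X.starProjection) ∘L U.subtypeL) := by
    ext x
    have hx := Submodule.starProjection_eq_self_iff.2 (X.starProjection_apply_mem x)
    simp [compareMap, hx]
  rw [e]
  exact ((h.comp_clm _).clm_comp _).neg.sub ((h'.comp_clm _).clm_comp _)

theorem starProjection_mul_of_le (h : W ≤ V) :
    W.starProjection * V.starProjection = W.starProjection :=
  Submodule.starProjection_comp_starProjection_of_le h

theorem range_starProjection_sub (h : W ≤ V) :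
    (V.starProjection - W.starProjection).range = V ⊓ Wᗮ := by
  ext x
  constructor
  · rintro ⟨y, rfl⟩
    refine ⟨V.sub_mem (V.starProjection_apply_mem y) (h (W.starProjection_apply_mem y)), ?_⟩
    rw [SetLike.mem_coe, ← Submodule.starProjection_apply_eq_zero_iff]
    have := DFunLike.congr_fun (starProjection_mul_of_le h) y
    simp only [mul_apply_eq_comp] at this
    have h' := Submodule.starProjection_eq_self_iff.2 (W.starProjection_apply_mem y)
    simp [this, h']
  · rintro ⟨hV, hW⟩
    refine ⟨x, ?_⟩
    have h1 := Submodule.starProjection_eq_self_iff.2 hV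
    have h2 := (Submodule.starProjection_apply_eq_zero_iff W).2 hW
    simp [h1, h2]

theorem relIndex_of_le (h : W ≤ V) :
    relIndex V W = Module.finrank ℂ (V.starProjection - W.starProjection).range := by
  have hs : Function.Surjective (compareMap V W) := by
    intro w
    refine ⟨⟨w, h w.2⟩, ?_⟩
    simp [compareMap]
  unfold relIndex fredholmIndex
  rw [LinearMap.index_of_surjective hs]
  have : (compareMap V W).ker.map V.subtype = (V.starProjection - W.starProjection).range := by
    rw [range_starProjection_sub h]
    ext x
    simp [compareMap, Submodule.mem_inf, and_comm]
  rw [← this, Submodule.finrank_map_subtype_eq]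

theorem isStarProjection_starProjection_sub (h : W ≤ V) :
    IsStarProjection (V.starProjection - W.starProjection) :=
  isStarProjection_starProjection.sub_of_mul_eq_left isStarProjection_starProjection
    (starProjection_mul_of_le h)

theorem finrank_range_eq_of_norm_sub_lt {p q : H →L[ℂ] H} (hp : IsStarProjection p)
    (hq : IsStarProjection q) (h : ‖p - q‖ < 1) :
    Module.finrank ℂ p.range = Module.finrank ℂ q.range := by
  obtain ⟨hp1, hp2⟩ := isStarProjection_iff_eq_starProjection_range.1 hp
  obtain ⟨hq1, hq2⟩ := isStarProjection_iff_eq_starProjection_range.1 hq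
  have : CompleteSpace p.range :=
    (ContinuousLinearMap.IsIdempotentElem.isClosed_range hp.isIdempotentElem).completeSpace_coe
  have : CompleteSpace q.range :=
    (ContinuousLinearMap.IsIdempotentElem.isClosed_range hq.isIdempotentElem).completeSpace_coe
  rw [hp2, hq2] at h
  exact (LinearEquiv.ofBijective (compareMap p.range q.range).toLinearMap
    (bijective_compareMap h)).finrank_eq

end RelativeIndex

section Spectral

set_option linter.unusedSectionVars false

variable {H : Type*} [NormedAddCommGroup H] [InnerProductSpace ℂ H] [CompleteSpace H]

/-- The continuous function equal to `1` on `(-∞, a]`, to `0` on `[b, ∞)`, affine in between. -/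
def ramp (a b x : ℝ) : ℝ := max 0 (min 1 ((b - x) / (b - a)))

theorem continuous_ramp (a b : ℝ) : Continuous (ramp a b) := by
  unfold ramp; fun_prop

theorem ramp_of_le {a b x : ℝ} (hab : a < b) (h : x ≤ a) : ramp a b x = 1 := by
  have : 1 ≤ (b - x) / (b - a) := by rw [one_le_div (by linarith)]; linarith
  simp [ramp, this]

theorem ramp_of_ge {a b x : ℝ} (hab : a < b) (h : b ≤ x) : ramp a b x = 0 := by
  have : (b - x) / (b - a) ≤ 0 := div_nonpos_of_nonpos_of_nonneg (by linarith) (by linarith)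
  simp [ramp, this]

/-- The range of the spectral projection `χ_{(-∞, t]}(F)`. -/
def lowerSubspace (F : H →L[ℂ] H) (t : ℝ) : Submodule ℂ H :=
  (cfc (fun x : ℝ => max (x - t) 0) F).ker

instance (F : H →L[ℂ] H) (t : ℝ) : CompleteSpace (lowerSubspace F t) :=
  inferInstanceAs (CompleteSpace (cfc (fun x : ℝ => max (x - t) 0) F).ker)

theorem spectralProjIic_eq (F : H →L[ℂ] H) (t : ℝ) :
    spectralProjIic F t = (lowerSubspace F t).starProjection := rfl

theorem lowerSubspace_mono (F : H →L[ℂ] H) : Monotone (lowerSubspace F) := by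
  intro a b hab
  rcases hab.eq_or_lt with rfl | hab
  · exact le_rfl
  have hc : Continuous fun x : ℝ => max (x - b) 0 / max (x - a) (b - a) := by
    refine Continuous.div (by fun_prop) (by fun_prop) fun x => ?_
    exact (lt_max_of_lt_right (sub_pos.2 hab)).ne'
  have e : cfc (fun x : ℝ => max (x - b) 0) F =
      cfc (fun x : ℝ => max (x - b) 0 / max (x - a) (b - a)) F *
        cfc (fun x : ℝ => max (x - a) 0) F := by
    rw [← cfc_mul _ _ F hc.continuousOn (by fun_prop)]
    congr 1
    ext x
    rcases le_total x b with h | h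
    · simp [h]
    · rw [max_eq_left (by linarith : 0 ≤ x - b), max_eq_left (by linarith : b - a ≤ x - a),
        max_eq_left (by linarith : 0 ≤ x - a), div_mul_cancel₀]
      linarith
  intro x hx
  have hx' : cfc (fun x : ℝ => max (x - a) 0) F x = 0 := hx
  change cfc (fun x : ℝ => max (x - b) 0) F x = 0
  rw [e, mul_apply_eq_comp, hx', map_zero]

theorem starProjection_congr {V W : Submodule ℂ H} [V.HasOrthogonalProjection]
    [W.HasOrthogonalProjection] (h : V = W) : V.starProjection = W.starProjection := by
  subst h; rfl

/-- Across a spectral gap, the spectral projection is given by the continuous functional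
calculus. -/
theorem spectralProjIic_eq_cfc {F : H →L[ℂ] H} (hF : IsSelfAdjoint F) {a b : ℝ} (hab : a < b)
    (h : ∀ x ∈ spectrum ℝ F, x ≤ a ∨ b ≤ x) : spectralProjIic F a = cfc (ramp a b) F := by
  have hr : ContinuousOn (ramp a b) (spectrum ℝ F) := (continuous_ramp a b).continuousOn
  have hE : IsStarProjection (cfc (ramp a b) F) := by
    refine ⟨?_, cfc_predicate _ _⟩
    rw [IsIdempotentElem, ← cfc_mul _ _ F hr hr]
    refine cfc_congr fun x hx => ?_
    rcases h x hx with h | h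
    · simp [ramp_of_le hab h]
    · simp [ramp_of_ge hab h]
  obtain ⟨h1, h2⟩ := isStarProjection_iff_eq_starProjection_range.1 hE
  rw [h2, spectralProjIic_eq]
  apply starProjection_congr
  apply le_antisymm
  · intro x hx
    have hx' : cfc (fun x : ℝ => max (x - a) 0) F x = 0 := hx
    have hc : Continuous fun x : ℝ => (1 - ramp a b x) / max (x - a) (b - a) := by
      refine Continuous.div (continuous_const.sub (continuous_ramp a b)) (by fun_prop) fun x => ?_
      exact (lt_max_of_lt_right (sub_pos.2 hab)).ne'
    have e : 1 - cfc (ramp a b) F = cfc (fun x : ℝ => (1 - ramp a b x) / max (x - a) (b - a)) F *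
        cfc (fun x : ℝ => max (x - a) 0) F := by
      rw [← cfc_mul _ _ F hc.continuousOn (by fun_prop), ← cfc_one ℝ F,
        ← cfc_sub _ _ F (by fun_prop) hr]
      refine cfc_congr fun x hx => ?_
      rcases h x hx with h | h
      · simp [ramp_of_le hab h]
      · rw [ramp_of_ge hab h]
        simp only [Pi.one_apply, sub_zero]
        rw [max_eq_left (by linarith), max_eq_left (by linarith), div_mul_cancel₀]
        linarith
    have e' := DFunLike.congr_fun e x
    rw [mul_apply_eq_comp, hx', map_zero] at e'
    exact ⟨x, (sub_eq_zero.1 e').symm⟩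
  · rintro _ ⟨x, rfl⟩
    change cfc (fun x : ℝ => max (x - a) 0) F (cfc (ramp a b) F x) = 0
    have e : cfc (fun x : ℝ => max (x - a) 0) F * cfc (ramp a b) F = 0 := by
      rw [← cfc_mul _ _ F (by fun_prop) hr, ← cfc_zero ℝ F]
      refine cfc_congr fun x hx => ?_
      rcases h x hx with h | h
      · simp [h]
      · simp [ramp_of_ge hab h]
    exact DFunLike.congr_fun e x

/-- Zero is isolated in the spectrum of a self-adjoint Fredholm operator. -/
theorem exists_isUnit_sub_of_isFredholm {A : H →L[ℂ] H} (hA : IsSelfAdjoint A)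
    (hAF : A.IsFredholm) :
    ∃ ε > 0, ∀ r : ℝ, r ≠ 0 → |r| < ε → IsUnit (A - (r : ℂ) • (1 : H →L[ℂ] H)) := by
  set E := A.ker.starProjection with hE
  have hEE : E * E = E := A.ker.isIdempotentElem_starProjection
  have hAE : A * E = 0 := by
    ext x
    exact A.ker.starProjection_apply_mem x
  have hEsa : IsSelfAdjoint E := isSelfAdjoint_starProjection _
  have hEA : E * A = 0 := by
    have := congrArg star hAE
    rwa [star_mul, hA.star_eq, hEsa.star_eq, star_zero] at this
  have hrange : A.range = A.kerᗮ := by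
    have h1 : A.rangeᗮ = A.ker := by
      rw [ContinuousLinearMap.orthogonal_range, ← ContinuousLinearMap.star_eq_adjoint, hA.star_eq]
    have : CompleteSpace A.range := hAF.isClosed_range.completeSpace_coe
    rw [← h1, Submodule.orthogonal_orthogonal]
  have hB : IsUnit (A + E) := by
    rw [ContinuousLinearMap.isUnit_iff_bijective]
    constructor
    · rw [injective_iff_map_eq_zero]
      intro x hx
      have h1 : E ((A + E) x) = 0 := by rw [hx, map_zero]
      have h2 : E (A x) = 0 := DFunLike.congr_fun hEA x
      have h3 : E (E x) = E x := DFunLike.congr_fun hEE x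
      rw [add_apply, map_add, h2, h3, zero_add] at h1
      rw [add_apply, h1, add_zero] at hx
      rw [← h1]
      exact (Submodule.starProjection_eq_self_iff.2 (show x ∈ A.ker from hx)).symm
    · intro y
      have h1 : y - E y ∈ A.range := by
        rw [hrange]; exact Submodule.sub_starProjection_mem_orthogonal y
      obtain ⟨x, hx⟩ := h1
      replace hx : A x = y - E y := hx
      refine ⟨x - E x + E y, ?_⟩
      have h2 : A (E x) = 0 := DFunLike.congr_fun hAE x
      have h2' : A (E y) = 0 := DFunLike.congr_fun hAE y
      have h3 : E (E x) = E x := DFunLike.congr_fun hEE x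
      have h3' : E (E y) = E y := DFunLike.congr_fun hEE y
      simp [h2, h2', h3, h3', hx]
  obtain ⟨ε, hε, hball⟩ := Metric.isOpen_iff.1 (Units.isOpen (R := H →L[ℂ] H)) (A + E) hB
  refine ⟨ε, hε, fun r hr hrε => ?_⟩
  have hu : IsUnit (A + E - (r : ℂ) • (1 : H →L[ℂ] H)) := by
    apply hball
    rw [Metric.mem_ball, dist_eq_norm, sub_sub_cancel_left, norm_neg, norm_smul]
    calc ‖(r : ℂ)‖ * ‖(1 : H →L[ℂ] H)‖ ≤ ‖(r : ℂ)‖ * 1 := by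
          gcongr; exact ContinuousLinearMap.norm_id_le
      _ < ε := by simpa using hrε
  obtain ⟨u, hu⟩ := hu
  have hr' : (r : ℂ) ≠ 0 := by exact_mod_cast hr
  have hAr : A - (r : ℂ) • (1 : H →L[ℂ] H) = u - E := by rw [hu]; abel
  have huE : (u : H →L[ℂ] H) * E = (1 - (r : ℂ)) • E := by
    rw [hu, sub_mul, add_mul, hAE, hEE, smul_mul_assoc, one_mul, zero_add, sub_smul, one_smul]
  have hEu : E * (u : H →L[ℂ] H) = (1 - (r : ℂ)) • E := by
    rw [hu, mul_sub, mul_add, hEA, hEE, mul_smul_comm, mul_one, zero_add, sub_smul, one_smul]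
  set v : H →L[ℂ] H := ↑u⁻¹ with hv
  have huv : (u : H →L[ℂ] H) * v = 1 := u.mul_inv
  have hvu : v * (u : H →L[ℂ] H) = 1 := u.inv_mul
  have hcomm : v * E = E * v := by
    have : (u : H →L[ℂ] H) * E = E * u := by rw [huE, hEu]
    calc v * E = v * (E * u) * v := by rw [mul_assoc, mul_assoc, huv, mul_one]
      _ = E * v := by rw [← this, ← mul_assoc, hvu, one_mul]
  refine isUnit_iff_exists.2 ⟨v * (1 - E) - (r : ℂ)⁻¹ • E, ?_, ?_⟩
  · have e1 : (↑u - E) * (v * (1 - E)) = 1 - E := by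
      rw [sub_mul, ← mul_assoc, huv, one_mul, ← mul_assoc, ← hcomm, mul_assoc, mul_sub, mul_one,
        hEE, sub_self, mul_zero, sub_zero]
    have e2 : (↑u - E) * ((r : ℂ)⁻¹ • E) = -E := by
      rw [mul_smul_comm, sub_mul, huE, hEE, sub_smul, one_smul, sub_sub_cancel_left, smul_neg,
        smul_smul, inv_mul_cancel₀ hr', one_smul]
    rw [hAr, mul_sub, e1, e2]
    abel
  · have e1 : (v * (1 - E)) * (↑u - E) = 1 - E := by
      have : (1 - E) * (↑u - E) = u * (1 - E) := by
        rw [sub_mul, mul_sub, mul_sub, mul_sub, hEu, ← huE, hEE]; simp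
      rw [mul_assoc, this, ← mul_assoc, hvu, one_mul]
    have e2 : ((r : ℂ)⁻¹ • E) * (↑u - E) = -E := by
      rw [smul_mul_assoc, mul_sub, hEu, hEE, sub_smul, one_smul, sub_sub_cancel_left, smul_neg,
        smul_smul, inv_mul_cancel₀ hr', one_smul]
    rw [hAr, sub_mul, e1, e2]
    abel

theorem mem_spectrum_iff_not_isUnit_sub_smul {F : H →L[ℂ] H} {x : ℝ} :
    x ∈ spectrum ℝ F ↔ ¬ IsUnit (F - (x : ℂ) • (1 : H →L[ℂ] H)) := by
  rw [spectrum.mem_iff, ← neg_sub F, IsUnit.neg_iff]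
  have : algebraMap ℝ (H →L[ℂ] H) x = (x : ℂ) • (1 : H →L[ℂ] H) := by
    rw [Algebra.algebraMap_eq_smul_one]; simp
  rw [this]

theorem isSelfAdjoint_sub_smul {F : H →L[ℂ] H} (hF : IsSelfAdjoint F) (t : ℝ) :
    IsSelfAdjoint (F - (t : ℂ) • (1 : H →L[ℂ] H)) := by
  refine hF.sub ?_
  rw [IsSelfAdjoint, star_smul, star_one]
  simp

theorem exists_spectrum_isolated {F : H →L[ℂ] H} (hF : IsSelfAdjoint F) {t : ℝ}
    (h : (F - (t : ℂ) • (1 : H →L[ℂ] H)).IsFredholm) :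
    ∃ ε > 0, ∀ x ∈ spectrum ℝ F, |x - t| < ε → x = t := by
  obtain ⟨ε, hε, h'⟩ := exists_isUnit_sub_of_isFredholm (isSelfAdjoint_sub_smul hF t) h
  refine ⟨ε, hε, fun x hx hxt => ?_⟩
  by_contra hne
  refine mem_spectrum_iff_not_isUnit_sub_smul.1 hx ?_
  have := h' (x - t) (sub_ne_zero.2 hne) hxt
  rw [sub_sub, ← add_smul] at this
  simpa using this

theorem isCompactCLM_cfc_sub {F G : H →L[ℂ] H} (hF : IsSelfAdjoint F) (hG : IsSelfAdjoint G)
    (h : IsCompactCLM (F - G)) {f : ℝ → ℝ} (hf : Continuous f) :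
    IsCompactCLM (cfc f F - cfc f G) := by
  have hpow : ∀ n : ℕ, IsCompactCLM (F ^ n - G ^ n) := by
    intro n
    induction n with
    | zero => simpa using IsCompactCLM.zero
    | succ n ih =>
      have e : F ^ (n + 1) - G ^ (n + 1) = (F ^ n - G ^ n) * F + G ^ n * (F - G) := by
        rw [pow_succ, pow_succ]; noncomm_ring
      rw [e]
      exact (ih.mul_right F).add (h.mul_left _)
  have hpoly : ∀ p : Polynomial ℝ, IsCompactCLM (Polynomial.aeval F p - Polynomial.aeval G p) := by
    intro p
    induction p using Polynomial.induction_on' with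
    | add p q hp hq =>
      rw [map_add, map_add, add_sub_add_comm]
      exact hp.add hq
    | monomial n a =>
      rw [Polynomial.aeval_monomial, Polynomial.aeval_monomial, ← mul_sub]
      exact (hpow n).mul_left _
  obtain ⟨R, hR⟩ : ∃ R : ℝ, spectrum ℝ F ⊆ Set.Icc (-R) R ∧ spectrum ℝ G ⊆ Set.Icc (-R) R := by
    obtain ⟨R, hR⟩ := (((ContinuousFunctionalCalculus.isCompact_spectrum (R := ℝ) F).union
      (ContinuousFunctionalCalculus.isCompact_spectrum (R := ℝ) G)).isBounded).subset_closedBall 0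
    refine ⟨R, ?_, ?_⟩ <;> intro x hx
    · simpa [abs_le] using hR (Or.inl hx)
    · simpa [abs_le] using hR (Or.inr hx)
  have hcl : IsClosed {T : H →L[ℂ] H | IsCompactCLM T} := isClosed_setOfPred_isCompactOperator
  have : cfc f F - cfc f G ∈ closure {T : H →L[ℂ] H | IsCompactCLM T} := by
    rw [Metric.mem_closure_iff]
    intro ε hε
    obtain ⟨p, hp⟩ := exists_polynomial_near_of_continuousOn (-R) R f hf.continuousOn (ε / 3)
      (by positivity)
    refine ⟨_, hpoly p, ?_⟩
    have key : ∀ A : H →L[ℂ] H, IsSelfAdjoint A → spectrum ℝ A ⊆ Set.Icc (-R) R →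
        ‖cfc f A - Polynomial.aeval A p‖ ≤ ε / 3 := by
      intro A hA hAR
      rw [← cfc_polynomial p A, ← cfc_sub _ _ A hf.continuousOn p.continuous.continuousOn]
      refine norm_cfc_le (by positivity) fun x hx => ?_
      rw [Real.norm_eq_abs, abs_sub_comm]
      exact (hp x (hAR hx)).le
    have k1 := key F hF hR.1
    have k2 := key G hG hR.2
    rw [dist_eq_norm]
    have e : cfc f F - cfc f G - (Polynomial.aeval F p - Polynomial.aeval G p) =
      (cfc f F - Polynomial.aeval F p) - (cfc f G - Polynomial.aeval G p) := by abel
    rw [e]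
    refine (norm_sub_le _ _).trans_lt ?_
    linarith
  rwa [hcl.closure_eq] at this

end Spectral

section SpectralGap

open Topology Filter

variable {H : Type*} [NormedAddCommGroup H] [InnerProductSpace ℂ H] [CompleteSpace H]

theorem SFHat.isSelfAdjoint {F : H →L[ℂ] H} (hF : F ∈ SFHat H) : IsSelfAdjoint F := hF.1.1

theorem SFHat.isFredholm_sub {F : H →L[ℂ] H} (hF : F ∈ SFHat H) {t : ℝ}
    (ht : t ∈ Set.Ioo (-1 : ℝ) 1) : (F - (t : ℂ) • (1 : H →L[ℂ] H)).IsFredholm := by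
  by_contra h
  have h' : (t : ℂ) ∈ essentialSpectrum F := h
  rw [hF.2.2] at h'
  rcases h' with h' | h'
  · have : t = -1 := by exact_mod_cast h'
    linarith [ht.1]
  · have : t = 1 := by exact_mod_cast Set.mem_singleton_iff.1 h'
    linarith [ht.2]

/-- The spectrum is discrete inside `(-1, 1)`. -/
theorem SFHat.exists_isolated {F : H →L[ℂ] H} (hF : F ∈ SFHat H) {t : ℝ}
    (ht : t ∈ Set.Ioo (-1 : ℝ) 1) : ∃ ε > 0, ∀ x ∈ spectrum ℝ F, |x - t| < ε → x = t :=
  exists_spectrum_isolated (SFHat.isSelfAdjoint hF) (SFHat.isFredholm_sub hF ht)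

theorem SFHat.exists_gap {F : H →L[ℂ] H} (hF : F ∈ SFHat H) {t : ℝ}
    (ht : t ∈ Set.Ioo (-1 : ℝ) 1) : ∃ ε > 0, ∀ x ∈ spectrum ℝ F, x ≤ t ∨ t + ε ≤ x := by
  obtain ⟨ε, hε, h⟩ := SFHat.exists_isolated hF ht
  refine ⟨ε, hε, fun x hx => ?_⟩
  by_contra! hc
  have := h x hx (by rw [abs_lt]; constructor <;> linarith)
  linarith

/-- `F` is self-adjoint with spectrum disjoint from `[a, b]`. -/
def HasGap (a b : ℝ) (F : H →L[ℂ] H) : Prop :=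
  IsSelfAdjoint F ∧ spectrum ℝ F ⊆ Set.Iio a ∪ Set.Ioi b

theorem HasGap.spectralProjIic_eq_cfc {a b : ℝ} (hab : a < b) {F : H →L[ℂ] H} (h : HasGap a b F) :
    spectralProjIic F a = cfc (ramp a b) F := by
  refine PairFlow.spectralProjIic_eq_cfc h.1 hab fun x hx => ?_
  rcases h.2 hx with h | h
  · exact Or.inl h.le
  · exact Or.inr h.le

theorem continuousOn_spectralProjIic {a b : ℝ} (hab : a < b) :
    ContinuousOn (fun F : H →L[ℂ] H => spectralProjIic F a) {F | HasGap a b F} := by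
  have h : ContinuousOn (fun F : H →L[ℂ] H => cfc (ramp a b) F) {F | HasGap a b F} :=
    ContinuousOn.cfc_of_mem_nhdsSet (s := Set.univ) _ (by simp) continuousOn_id
      (fun x hx => hx.1) (continuous_ramp a b).continuousOn
  exact h.congr fun F hF => HasGap.spectralProjIic_eq_cfc hab hF

theorem isOpen_spectrum_subset {s : Set ℝ} (hs : IsOpen s) :
    IsOpen {F : H →L[ℂ] H | spectrum ℝ F ⊆ s} := by
  have := (upperHemicontinuous_spectrum ℝ (H →L[ℂ] H)).isOpen s
  simpa only [hs.mem_nhdsSet] using this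

/-- There are spectral gaps immediately to the right of any `t` in `(-1, 1)`. -/
theorem SFHat.exists_hasGap {F : H →L[ℂ] H} (hF : F ∈ SFHat H) {t b : ℝ}
    (ht : t ∈ Set.Ioo (-1 : ℝ) 1) (hb : t < b) :
    ∃ c d, t < c ∧ c < d ∧ d < b ∧ HasGap c d F := by
  obtain ⟨ε, hε, h⟩ := SFHat.exists_gap hF ht
  have hm : 0 < min ε (b - t) := lt_min hε (sub_pos.2 hb)
  have h1 := min_le_left ε (b - t)
  have h2 := min_le_right ε (b - t)
  refine ⟨t + min ε (b - t) / 3, t + min ε (b - t) / 2, by linarith, by linarith, by linarith,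
    (SFHat.isSelfAdjoint hF), fun x hx => ?_⟩
  rcases h x hx with h | h
  · left; rw [Set.mem_Iio]; linarith
  · right; rw [Set.mem_Ioi]; linarith

theorem SFHat.exists_hasGap_left {F : H →L[ℂ] H} (hF : F ∈ SFHat H) {t b : ℝ}
    (ht : t ∈ Set.Ioo (-1 : ℝ) 1) (hb : b < t) :
    ∃ c d, b < c ∧ c < d ∧ d < t ∧ HasGap c d F := by
  obtain ⟨ε, hε, h⟩ := SFHat.exists_isolated hF ht
  have hm : 0 < min ε (t - b) := lt_min hε (sub_pos.2 hb)
  have h1 := min_le_left ε (t - b)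
  have h2 := min_le_right ε (t - b)
  refine ⟨t - min ε (t - b) / 2, t - min ε (t - b) / 3, by linarith, by linarith, by linarith,
    (SFHat.isSelfAdjoint hF), fun x hx => ?_⟩
  by_contra hc
  simp only [Set.mem_union, Set.mem_Iio, Set.mem_Ioi, not_or, not_lt] at hc
  have := h x hx (by rw [abs_lt]; constructor <;> linarith)
  linarith

theorem isCompactCLM_spectralProjIic_sub {F G : H →L[ℂ] H} (hF : F ∈ SFHat H) (hG : G ∈ SFHat H)
    (h : IsCompactCLM (F - G)) {t : ℝ} (ht : t ∈ Set.Ioo (-1 : ℝ) 1) :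
    IsCompactCLM (spectralProjIic F t - spectralProjIic G t) := by
  obtain ⟨ε, hε, h₁⟩ := SFHat.exists_gap hF ht
  obtain ⟨δ, hδ, h₂⟩ := SFHat.exists_gap hG ht
  have hm : t < t + min ε δ := by linarith [lt_min hε hδ]
  rw [spectralProjIic_eq_cfc (SFHat.isSelfAdjoint hF) hm fun x hx => (h₁ x hx).imp_right fun h => by
      linarith [min_le_left ε δ],
    spectralProjIic_eq_cfc (SFHat.isSelfAdjoint hG) hm fun x hx => (h₂ x hx).imp_right fun h => by
      linarith [min_le_right ε δ]]
  exact isCompactCLM_cfc_sub (SFHat.isSelfAdjoint hF) (SFHat.isSelfAdjoint hG) h (continuous_ramp _ _)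

/-- Near an isolated point `t` of the spectrum, spectral projections change by the projection onto
the eigenspace of `t`. -/
theorem range_spectralProjIic_sub_le {F : H →L[ℂ] H} (hF : IsSelfAdjoint F) {t ε : ℝ}
    (h : ∀ x ∈ spectrum ℝ F, |x - t| < ε → x = t) {s : ℝ} (hs : |s - t| < ε) :
    (spectralProjIic F t - spectralProjIic F s).range ≤
      (F - (t : ℂ) • (1 : H →L[ℂ] H)).ker := by
  have hε : 0 < ε := (abs_nonneg _).trans_lt hs
  have hst := abs_lt.1 hs
  rcases eq_or_ne s t with rfl | hne
  · simp
  obtain ⟨d, hsd, hd⟩ : ∃ d, s < d ∧ ∀ x ∈ spectrum ℝ F, x ≤ s ∨ d ≤ x := by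
    rcases lt_or_gt_of_ne hne with hlt | hgt
    · refine ⟨t, hlt, fun x hx => ?_⟩
      by_contra! hc
      have := h x hx (by rw [abs_lt]; constructor <;> linarith)
      linarith
    · refine ⟨t + ε, by linarith, fun x hx => ?_⟩
      by_contra! hc
      have := h x hx (by rw [abs_lt]; constructor <;> linarith)
      linarith
  have ht : ∀ x ∈ spectrum ℝ F, x ≤ t ∨ t + ε ≤ x := by
    intro x hx
    by_contra! hc
    have := h x hx (by rw [abs_lt]; constructor <;> linarith)
    linarith
  rw [spectralProjIic_eq_cfc hF (by linarith : t < t + ε) ht, spectralProjIic_eq_cfc hF hsd hd]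
  have e : (F - (t : ℂ) • (1 : H →L[ℂ] H)) * (cfc (ramp t (t + ε)) F - cfc (ramp s d) F) = 0 := by
    have e1 : F - (t : ℂ) • (1 : H →L[ℂ] H) = cfc (fun x : ℝ => x - t) F := by
      rw [cfc_sub _ _ F (by fun_prop) (by fun_prop), cfc_id' ℝ F, cfc_const t F,
        Algebra.algebraMap_eq_smul_one]
      simp
    have c1 := (continuous_ramp t (t + ε)).continuousOn (s := spectrum ℝ F)
    have c2 := (continuous_ramp s d).continuousOn (s := spectrum ℝ F)
    have c3 : ContinuousOn (fun x => ramp t (t + ε) x - ramp s d x) (spectrum ℝ F) := c1.sub c2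
    rw [e1, ← cfc_sub _ _ F c1 c2, ← cfc_mul _ _ F (by fun_prop) c3, ← cfc_zero ℝ F]
    refine cfc_congr fun x hx => ?_
    simp only [Pi.zero_apply, mul_eq_zero]
    by_cases hx' : |x - t| < ε
    · left; rw [h x hx hx', sub_self]
    · right
      rw [abs_lt, not_and_or, not_lt, not_lt] at hx'
      rcases hx' with hx' | hx'
      · rw [ramp_of_le (by linarith) (by linarith), ramp_of_le hsd (by linarith), sub_self]
      · rw [ramp_of_ge (by linarith) (by linarith), ramp_of_ge hsd, sub_self]
        rcases hd x hx with h' | h'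
        · linarith
        · exact h'
  rintro _ ⟨x, rfl⟩
  exact DFunLike.congr_fun e x

theorem SFHat.finiteDimensional_range_sub {F : H →L[ℂ] H} (hF : F ∈ SFHat H) {s t : ℝ}
    (hs : s ∈ Set.Ioo (-1 : ℝ) 1) (ht : t ∈ Set.Ioo (-1 : ℝ) 1) :
    FiniteDimensional ℂ (spectralProjIic F s - spectralProjIic F t).range := by
  refine isPreconnected_Ioo.induction₂
    (fun s t => FiniteDimensional ℂ (spectralProjIic F s - spectralProjIic F t).range)
    ?_ ?_ ?_ hs ht
  · intro t ht
    obtain ⟨ε, hε, h⟩ := SFHat.exists_isolated hF ht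
    have := (SFHat.isFredholm_sub hF ht).finite_ker
    filter_upwards [mem_nhdsWithin_of_mem_nhds (Metric.ball_mem_nhds t hε)] with s hs
    exact Submodule.finiteDimensional_of_le (range_spectralProjIic_sub_le (SFHat.isSelfAdjoint hF) h hs)
  · intro x y z _ _ _ h1 h2
    have : (spectralProjIic F x - spectralProjIic F z).range ≤
        (spectralProjIic F x - spectralProjIic F y).range ⊔
        (spectralProjIic F y - spectralProjIic F z).range := by
      have := LinearMap.range_add_le (spectralProjIic F x - spectralProjIic F y).toLinearMap
        (spectralProjIic F y - spectralProjIic F z).toLinearMap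
      rwa [← ContinuousLinearMap.toLinearMap_add, sub_add_sub_cancel] at this
    exact Submodule.finiteDimensional_of_le this
  · intro x y _ _ h
    rw [← neg_sub, ContinuousLinearMap.toLinearMap_neg, LinearMap.range_neg]
    exact h

/-- Self-adjoint compact perturbations of norm at most one stay in `SFHat H`. -/
theorem SFHat.of_isCompactCLM_sub {F G : H →L[ℂ] H} (hF : F ∈ SFHat H) (hG : IsSelfAdjoint G)
    (h : IsCompactCLM (G - F)) (hn : ‖G‖ ≤ 1) : G ∈ SFHat H := by
  have hess : essentialSpectrum G = essentialSpectrum F := by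
    ext z
    refine not_congr ⟨fun hz => isFredholm_of_isCompactCLM_sub hz ?_,
      fun hz => isFredholm_of_isCompactCLM_sub hz ?_⟩
    · rw [sub_sub_sub_cancel_right, ← neg_sub]; exact h.neg
    · rw [sub_sub_sub_cancel_right]; exact h
  refine ⟨⟨hG, isFredholm_of_isCompactCLM_sub hF.1.2.1 h, ?_, ?_⟩, hn.antisymm ?_, ?_⟩
  · rw [hess]; exact hF.1.2.2.1
  · rw [hess]; exact hF.1.2.2.2
  · have h1 : ((1 : ℝ) : ℂ) ∈ essentialSpectrum G := by rw [hess, hF.2.2]; simp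
    have h2 : (1 : ℝ) ∈ spectrum ℝ G :=
      mem_spectrum_iff_not_isUnit_sub_smul.2 fun hu => h1 (isFredholm_of_isUnit hu)
    have h3 := spectrum.norm_le_norm_mul_of_mem h2
    rw [norm_one] at h3
    exact h3.trans (mul_le_of_le_one_right (norm_nonneg _) ContinuousLinearMap.norm_id_le)
  · rw [hess, hF.2.2]

end SpectralGap

section Flow

open Topology Filter

variable {H : Type*} [NormedAddCommGroup H] [InnerProductSpace ℂ H] [CompleteSpace H]

theorem range_spectralProj_finiteDimensional {F : H →L[ℂ] H} (hF : F ∈ SFHat H) {a b : ℝ}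
    (ha : a ∈ Set.Ioo (-1 : ℝ) 1) (hb : b ∈ Set.Ioo (-1 : ℝ) 1) :
    FiniteDimensional ℂ (spectralProj a b F).range :=
  SFHat.finiteDimensional_range_sub hF hb ha

theorem relIndex_lowerSubspace_of_le {F : H →L[ℂ] H} {a b : ℝ} (hab : a ≤ b) :
    relIndex (lowerSubspace F b) (lowerSubspace F a) =
      Module.finrank ℂ (spectralProj a b F).range :=
  relIndex_of_le (lowerSubspace_mono F hab)

theorem isCompactCLM_spectralProj {F : H →L[ℂ] H} (hF : F ∈ SFHat H) {a b : ℝ}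
    (ha : a ∈ Set.Ioo (-1 : ℝ) 1) (hb : b ∈ Set.Ioo (-1 : ℝ) 1) :
    IsCompactCLM (spectralProjIic F b - spectralProjIic F a) :=
  .of_hasFiniteRange ((Submodule.fg_iff_finiteDimensional _).2
    (SFHat.finiteDimensional_range_sub hF hb ha))

/-- A change of level shifts the relative index by the ranks of spectral projections. -/
theorem relIndex_lowerSubspace_change_level {F G : H →L[ℂ] H} (hF : F ∈ SFHat H)
    (hG : G ∈ SFHat H) (h : IsCompactCLM (F - G)) {a b : ℝ} (hab : a ≤ b)
    (ha : a ∈ Set.Ioo (-1 : ℝ) 1) (hb : b ∈ Set.Ioo (-1 : ℝ) 1) :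
    relIndex (lowerSubspace F b) (lowerSubspace G b) =
      relIndex (lowerSubspace F a) (lowerSubspace G a) +
      ((Module.finrank ℂ (spectralProj a b F).range : ℤ) -
        Module.finrank ℂ (spectralProj a b G).range) := by
  have h1 := relIndex_add (V := lowerSubspace F b) (W := lowerSubspace F a)
    (X := lowerSubspace G a) (isCompactCLM_spectralProj hF ha hb)
    (isCompactCLM_spectralProjIic_sub hF hG h ha)
  have h2 := relIndex_add (V := lowerSubspace F b) (W := lowerSubspace G b)
    (X := lowerSubspace G a) (isCompactCLM_spectralProjIic_sub hF hG h hb)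
    (isCompactCLM_spectralProj hG ha hb)
  rw [relIndex_lowerSubspace_of_le hab] at h1 h2
  linarith

theorem spectralProj_mul_of_mem {F : H →L[ℂ] H} {a b c : ℝ} (hac : a ≤ c) (hcb : c ≤ b) :
    spectralProj a b F * spectralProjIic F c = spectralProjIic F c - spectralProjIic F a := by
  have h1 : spectralProjIic F a * spectralProjIic F c = spectralProjIic F a :=
    starProjection_mul_of_le (lowerSubspace_mono F hac)
  have h2 : spectralProjIic F c * spectralProjIic F b = spectralProjIic F c :=
    starProjection_mul_of_le (lowerSubspace_mono F hcb)
  have h3 : spectralProjIic F b * spectralProjIic F c = spectralProjIic F c := by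
    have e := congrArg star h2
    have s : ∀ t, star (spectralProjIic F t) = spectralProjIic F t := fun t =>
      isSelfAdjoint_starProjection _
    rwa [star_mul, s, s] at e
  rw [spectralProj, sub_mul, h1, h3]

variable {X : Type*} [TopologicalSpace X]

theorem continuousAt_spectralProjIic {γ : X → H →L[ℂ] H} {x : X} (hγ : ContinuousAt γ x)
    (hsa : ∀ y, IsSelfAdjoint (γ y)) {c d : ℝ} (hcd : c < d) (h : HasGap c d (γ x)) :
    ContinuousAt (fun y => spectralProjIic (γ y) c) x := by
  have hO := isOpen_spectrum_subset (H := H) (s := Set.Iio c ∪ Set.Ioi d)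
    (isOpen_Iio.union isOpen_Ioi)
  have h1 : ∀ᶠ y in 𝓝 x, HasGap c d (γ y) := by
    filter_upwards [hγ (hO.mem_nhds h.2)] with y hy
    exact ⟨hsa y, hy⟩
  exact ((continuousOn_spectralProjIic hcd) (γ x) h).tendsto.comp
    (tendsto_nhdsWithin_iff.2 ⟨hγ, h1⟩)

/-- Norm continuity of `χ_{(a, b]}(γ s)` forces norm continuity of `χ_{(-∞, a]}(γ s)`. -/
theorem continuousOn_spectralProjIic_of_spectralProj {γ : X → H →L[ℂ] H} (hγ : Continuous γ)
    (hS : ∀ s, γ s ∈ SFHat H) {a b : ℝ} (ha : a ∈ Set.Ioo (-1 : ℝ) 1) (hab : a < b) {J : Set X}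
    (hJ : ContinuousOn (fun s => spectralProj a b (γ s)) J) :
    ContinuousOn (fun s => spectralProjIic (γ s) a) J := by
  intro x hx
  obtain ⟨c, d, hac, hcd, hdb, hgap⟩ := SFHat.exists_hasGap (hS x) ha hab
  have h1 := (continuousAt_spectralProjIic hγ.continuousAt
    (fun y => SFHat.isSelfAdjoint (hS y)) hcd hgap).continuousWithinAt (s := J)
  refine (h1.sub ((hJ x hx).mul h1)).congr (fun y _ => ?_) ?_ <;>
  simp only [Pi.sub_apply, Pi.mul_apply] <;>
  rw [spectralProj_mul_of_mem hac.le (hcd.trans hdb).le, sub_sub_cancel]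

theorem relIndex_eq_zero_of_continuousOn {γ : X → H →L[ℂ] H}
    (hS : ∀ s, γ s ∈ SFHat H) (hK : ∀ s t, IsCompactCLM (γ s - γ t)) {a : ℝ}
    (ha : a ∈ Set.Ioo (-1 : ℝ) 1) {J : Set X} (hJ : IsPreconnected J)
    (hc : ContinuousOn (fun s => spectralProjIic (γ s) a) J) {x y : X} (hx : x ∈ J) (hy : y ∈ J) :
    relIndex (lowerSubspace (γ x) a) (lowerSubspace (γ y) a) = 0 := by
  have hcomp : ∀ s t, IsCompactCLM ((lowerSubspace (γ s) a).starProjection -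
      (lowerSubspace (γ t) a).starProjection) := fun s t =>
    isCompactCLM_spectralProjIic_sub (hS s) (hS t) (hK s t) ha
  refine hJ.induction₂
    (fun x y => relIndex (lowerSubspace (γ x) a) (lowerSubspace (γ y) a) = 0) ?_ ?_ ?_ hx hy
  · intro x hx
    have := Metric.tendsto_nhds.1 (hc x hx) 1 one_pos
    filter_upwards [this] with y hy
    rw [dist_comm, dist_eq_norm] at hy
    exact relIndex_of_norm_sub_lt hy
  · intro x y z _ _ _ h1 h2
    rw [← relIndex_add (hcomp x y) (hcomp y z), h1, h2, add_zero]
  · intro x y _ _ h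
    rw [relIndex_swap (hcomp x y), h, neg_zero]

theorem sum_relIndex {N : ℕ} (V : Fin (N + 1) → Submodule ℂ H) [∀ n, CompleteSpace (V n)]
    (h : ∀ m n, IsCompactCLM ((V m).starProjection - (V n).starProjection)) :
    ∑ n : Fin N, relIndex (V n.castSucc) (V n.succ) = relIndex (V 0) (V (Fin.last N)) := by
  induction N with
  | zero => simpa using relIndex_self.symm
  | succ N ih =>
    rw [Fin.sum_univ_castSucc]
    have := ih (fun n => V n.castSucc) fun m n => h _ _
    simp only [← Fin.succ_castSucc] at this
    rw [this]
    exact relIndex_add (h _ _) (h _ _)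

/-- The spectral flow of a path of compact perturbations is the relative index of its
end points. -/
theorem HasSpectralFlow.eq_relIndex {γ : C(I, H →L[ℂ] H)} (hS : ∀ s, γ s ∈ SFHat H)
    (hK : ∀ s t, IsCompactCLM (γ s - γ t)) {m : ℤ} (hm : HasSpectralFlow γ m) :
    m = relIndex (lowerSubspace (γ 0) 0) (lowerSubspace (γ 1) 0) := by
  obtain ⟨N, t, a, b, ht, h0, h1, hab, hc, -, rfl⟩ := hm
  have hzero : (0 : ℝ) ∈ Set.Ioo (-1 : ℝ) 1 := by simp
  have hsum := sum_relIndex (fun n => lowerSubspace (γ (t n)) 0) fun m n =>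
    isCompactCLM_spectralProjIic_sub (hS (t m)) (hS (t n)) (hK _ _) hzero
  rw [h0, h1] at hsum
  rw [← hsum]
  refine Finset.sum_congr rfl fun n _ => ?_
  obtain ⟨ha1, ha0, hb0, hb1⟩ := hab n
  have ha : a n ∈ Set.Ioo (-1 : ℝ) 1 := ⟨ha1, by linarith⟩
  have hle : t n.castSucc ≤ t n.succ := ht.monotone n.castSucc_lt_succ.le
  rw [relIndex_lowerSubspace_change_level (hS _) (hS _) (hK _ _) ha0.le ha hzero,
    relIndex_eq_zero_of_continuousOn hS hK ha
      (isPreconnected_Icc (a := t n.castSucc) (b := t n.succ))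
      (continuousOn_spectralProjIic_of_spectralProj γ.continuous hS ha (ha0.trans hb0) (hc n))
      (Set.left_mem_Icc.2 hle) (Set.right_mem_Icc.2 hle), zero_add]

end Flow

section Existence

open Topology Filter

variable {H : Type*} [NormedAddCommGroup H] [InnerProductSpace ℂ H] [CompleteSpace H]

theorem isStarProjection_spectralProj {F : H →L[ℂ] H} {a b : ℝ} (hab : a ≤ b) :
    IsStarProjection (spectralProj a b F) :=
  isStarProjection_starProjection_sub (lowerSubspace_mono F hab)

theorem finrank_range_eq_of_continuousOn {X : Type*} [TopologicalSpace X] {p : X → H →L[ℂ] H}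
    (hp : ∀ x, IsStarProjection (p x)) {J : Set X} (hJ : IsPreconnected J)
    (hc : ContinuousOn p J) {x y : X} (hx : x ∈ J) (hy : y ∈ J) :
    Module.finrank ℂ (p x).range = Module.finrank ℂ (p y).range := by
  refine hJ.induction₂
    (fun x y => Module.finrank ℂ (p x).range = Module.finrank ℂ (p y).range) ?_ ?_ ?_ hx hy
  · intro x hx
    filter_upwards [Metric.tendsto_nhds.1 (hc x hx) 1 one_pos] with y hy
    rw [dist_comm, dist_eq_norm] at hy
    exact finrank_range_eq_of_norm_sub_lt (hp x) (hp y) hy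
  · intro x y z _ _ _ h1 h2
    exact h1.trans h2
  · intro x y _ _ h
    exact h.symm

/-- Locally along a path, levels can be chosen in spectral gaps. -/
theorem exists_isOpen_continuousOn_spectralProj {γ : C(I, H →L[ℂ] H)}
    (hS : ∀ s, γ s ∈ SFHat H) (s : I) :
    ∃ (a b : ℝ) (O : Set I), -1 < a ∧ a < 0 ∧ 0 < b ∧ b < 1 ∧ IsOpen O ∧ s ∈ O ∧
      ContinuousOn (fun r => spectralProj a b (γ r)) O := by
  have hzero : (0 : ℝ) ∈ Set.Ioo (-1 : ℝ) 1 := by simp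
  obtain ⟨a, a', ha, haa', ha'0, hga⟩ := SFHat.exists_hasGap_left (hS s) hzero
    (show (-1 : ℝ) < 0 by norm_num)
  obtain ⟨b, b', hb, hbb', hb'1, hgb⟩ := SFHat.exists_hasGap (hS s) hzero
    (show (0 : ℝ) < 1 by norm_num)
  have hO := fun c d : ℝ => (isOpen_spectrum_subset (H := H) (s := Set.Iio c ∪ Set.Ioi d)
    (isOpen_Iio.union isOpen_Ioi)).preimage γ.continuous
  refine ⟨a, b, _, ha, haa'.trans ha'0, hb, hbb'.trans hb'1, (hO a a').inter (hO b b'),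
    ⟨hga.2, hgb.2⟩, fun x hx => ?_⟩
  have key : ∀ c d : ℝ, c < d → spectrum ℝ (γ x) ⊆ Set.Iio c ∪ Set.Ioi d →
      ContinuousAt (fun r => spectralProjIic (γ r) c) x := fun c d hcd h =>
    continuousAt_spectralProjIic γ.continuous.continuousAt
      (fun y => SFHat.isSelfAdjoint (hS y)) hcd ⟨SFHat.isSelfAdjoint (hS x), h⟩
  exact ((key b b' hbb' hx.2).sub (key a a' haa' hx.1)).continuousWithinAt

theorem exists_strictMono_subdivision {c : I → Set I} (ho : ∀ s, IsOpen (c s))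
    (hc : ∀ s, s ∈ c s) : ∃ (N : ℕ) (t : Fin (N + 1) → I), StrictMono t ∧ t 0 = 0 ∧
      t (Fin.last N) = 1 ∧ ∀ n : Fin N, ∃ s, Set.Icc (t n.castSucc) (t n.succ) ⊆ c s := by
  obtain ⟨δ, hδ, h⟩ := lebesgue_number_lemma_of_metric (s := (Set.univ : Set I)) isCompact_univ ho
    fun s _ => Set.mem_iUnion.2 ⟨s, hc s⟩
  obtain ⟨M, hM⟩ := exists_nat_one_div_lt hδ
  have hM0 : (0 : ℝ) < (M : ℝ) + 1 := by positivity
  refine ⟨M + 1, fun n => ⟨(n : ℕ) / ((M : ℝ) + 1), by positivity, ?_⟩, ?_, ?_, ?_, ?_⟩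
  · rw [div_le_one hM0]
    exact_mod_cast Nat.lt_succ_iff.1 n.2
  · intro m n hmn
    change ((m : ℕ) : ℝ) / ((M : ℝ) + 1) < (n : ℕ) / ((M : ℝ) + 1)
    have : ((m : ℕ) : ℝ) < (n : ℕ) := by exact_mod_cast hmn
    gcongr
  · ext; simp
  · ext; simp [div_self hM0.ne']
  · intro n
    obtain ⟨s, hs⟩ := h ⟨((n.castSucc : Fin (M + 1 + 1)) : ℕ) / ((M : ℝ) + 1), by positivity, by
      rw [div_le_one hM0]; exact_mod_cast n.2.le⟩ (Set.mem_univ _)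
    refine ⟨s, fun x hx => hs ?_⟩
    rw [Metric.mem_ball, Subtype.dist_eq, Real.dist_eq]
    have h1 : ((n : ℕ) : ℝ) / ((M : ℝ) + 1) ≤ x := hx.1
    have h2 : (x : ℝ) ≤ ((n.succ : Fin (M + 1 + 1)) : ℕ) / ((M : ℝ) + 1) := hx.2
    rw [Fin.val_succ, Nat.cast_add, add_div, Nat.cast_one] at h2
    change |(x : ℝ) - ((n : ℕ) : ℝ) / ((M : ℝ) + 1)| < δ
    rw [abs_of_nonneg (by linarith)]
    linarith

/-- Every path in `SFHat H` has a spectral flow. -/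
theorem exists_hasSpectralFlow {γ : C(I, H →L[ℂ] H)} (hS : ∀ s, γ s ∈ SFHat H) :
    ∃ m, HasSpectralFlow γ m := by
  choose a b O ha ha0 hb0 hb hO hs hc using exists_isOpen_continuousOn_spectralProj hS
  obtain ⟨N, t, ht, h0, h1, hcov⟩ := exists_strictMono_subdivision hO hs
  choose s hsub using hcov
  refine ⟨_, N, t, fun n => a (s n), fun n => b (s n), ht, h0, h1,
    fun n => ⟨ha _, ha0 _, hb0 _, hb _⟩, fun n => (hc (s n)).mono (hsub n), fun n => ?_, rfl⟩
  refine ⟨Module.finrank ℂ (spectralProj (a (s n)) (b (s n)) (γ (t n.castSucc))).range,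
    fun x hx => ⟨?_, ?_⟩⟩
  · exact range_spectralProj_finiteDimensional (hS x) ⟨ha _, by linarith [ha0 (s n)]⟩
      ⟨by linarith [hb0 (s n)], hb _⟩
  · exact finrank_range_eq_of_continuousOn
      (fun x => isStarProjection_spectralProj ((ha0 (s n)).trans (hb0 (s n))).le)
      isPreconnected_Icc ((hc (s n)).mono (hsub n)) hx
      (Set.left_mem_Icc.2 (hx.1.trans hx.2))

theorem isCompactCLM_conj_sub {F U : H →L[ℂ] H} (hU : U ∈ unitary (H →L[ℂ] H))
    (h : IsCompactCLM (F * U - U * F)) : IsCompactCLM (star U * F * U - F) := by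
  have e : star U * F * U - F = star U * (F * U - U * F) := by
    rw [mul_sub, ← mul_assoc, ← mul_assoc, Unitary.star_mul_self_of_mem hU, one_mul]
  rw [e]
  exact h.mul_left _

theorem conj_mem_SFHat {F U : H →L[ℂ] H} (hF : F ∈ SFHat H) (hU : U ∈ unitary (H →L[ℂ] H))
    (h : IsCompactCLM (F * U - U * F)) : star U * F * U ∈ SFHat H := by
  refine SFHat.of_isCompactCLM_sub hF ((SFHat.isSelfAdjoint hF).conjugate' U)
    (isCompactCLM_conj_sub hU h) ?_
  rw [CStarRing.norm_mul_mem_unitary _ hU,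
    CStarRing.norm_mem_unitary_mul _ (Unitary.star_mem hU), hF.2.1]

theorem Theta.nonempty {F U : H →L[ℂ] H} (hF : F ∈ SFHat H) (hU : U ∈ unitary (H →L[ℂ] H))
    (h : IsCompactCLM (F * U - U * F)) : (Theta F U).Nonempty := by
  have hG := conj_mem_SFHat hF hU h
  have hK := isCompactCLM_conj_sub hU h
  set G := star U * F * U with hGdef
  have hKs : ∀ s : I, IsCompactCLM (F + ((s : ℝ) : ℂ) • (G - F) - F) := fun s => by
    rw [add_sub_cancel_left]; exact hK.smul _
  refine ⟨⟨fun s => F + ((s : ℝ) : ℂ) • (G - F), by fun_prop⟩, fun s => ?_, by simp, hKs, by simp [hGdef]⟩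
  refine SFHat.of_isCompactCLM_sub hF ?_ (hKs s) ?_
  · refine (SFHat.isSelfAdjoint hF).add ?_
    have := (SFHat.isSelfAdjoint hG).sub (SFHat.isSelfAdjoint hF)
    rw [IsSelfAdjoint, star_smul, this.star_eq]
    simp
  · have e : F + ((s : ℝ) : ℂ) • (G - F) = ((1 - (s : ℝ) : ℝ) : ℂ) • F + ((s : ℝ) : ℂ) • G := by
      push_cast
      module
    change ‖F + ((s : ℝ) : ℂ) • (G - F)‖ ≤ 1
    rw [e]
    refine (norm_add_le _ _).trans ?_
    rw [norm_smul, norm_smul, hF.2.1, hG.2.1, Complex.norm_real, Complex.norm_real,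
      Real.norm_of_nonneg s.2.1, Real.norm_of_nonneg (by linarith [s.2.2])]
    linarith

theorem hasSpectralFlow_iff {F U : H →L[ℂ] H} {γ : C(I, H →L[ℂ] H)} (hγ : γ ∈ Theta F U) (m : ℤ) :
    HasSpectralFlow γ m ↔
      m = relIndex (lowerSubspace F 0) (lowerSubspace (star U * F * U) 0) := by
  obtain ⟨hS, h0, hK, h1⟩ := hγ
  have hK' : ∀ s t, IsCompactCLM (γ s - γ t) := fun s t => by
    have := IsCompactCLM.sub (hK s) (hK t)
    rwa [sub_sub_sub_cancel_right] at this
  have key : ∀ m, HasSpectralFlow γ m →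
      m = relIndex (lowerSubspace F 0) (lowerSubspace (star U * F * U) 0) := fun m hm => by
    rw [HasSpectralFlow.eq_relIndex hS hK' hm]
    congr!
  refine ⟨key m, ?_⟩
  rintro rfl
  obtain ⟨m, hm⟩ := exists_hasSpectralFlow hS
  rwa [← key m hm]

theorem SF_eq_relIndex (p : Pairs H) : SF p =
    relIndex (lowerSubspace p.1.1 0) (lowerSubspace (star p.1.2 * p.1.1 * p.1.2) 0) := by
  have h : ∃ m : ℤ, ∀ γ ∈ Theta p.1.1 p.1.2, HasSpectralFlow γ m :=
    ⟨_, fun γ hγ => (hasSpectralFlow_iff hγ _).2 rfl⟩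
  rw [SF, dif_pos h]
  obtain ⟨γ, hγ⟩ := Theta.nonempty p.2.1 p.2.2.1 p.2.2.2
  exact (hasSpectralFlow_iff hγ _).1 (h.choose_spec γ hγ)

end Existence

section LocalConstancy

open Topology Filter

variable {H : Type*} [NormedAddCommGroup H] [InnerProductSpace ℂ H] [CompleteSpace H]

theorem cfc_conj {F U : H →L[ℂ] H} (hF : IsSelfAdjoint F) (hU : U ∈ unitary (H →L[ℂ] H))
    {f : ℝ → ℝ} (hf : Continuous f) : cfc f (star U * F * U) = star U * cfc f F * U := by
  have h := StarAlgHomClass.map_cfc (S := ℂ) (p := IsSelfAdjoint) (q := IsSelfAdjoint)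
    (Unitary.conjStarAlgAut ℂ (H →L[ℂ] H) (star ⟨U, hU⟩)) f F hf.continuousOn
    (by
      change Continuous fun x => _
      simp only [Unitary.conjStarAlgAut_star_apply]
      fun_prop) hF
    (by
      rw [Unitary.conjStarAlgAut_star_apply]
      exact hF.conjugate' U)
  rw [Unitary.conjStarAlgAut_star_apply, Unitary.conjStarAlgAut_star_apply] at h
  exact h.symm

theorem spectralProjIic_conj {F U : H →L[ℂ] H} (hF : IsSelfAdjoint F)
    (hU : U ∈ unitary (H →L[ℂ] H)) (t : ℝ) :
    spectralProjIic (star U * F * U) t = star U * spectralProjIic F t * U := by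
  have hUU : U * star U = 1 := Unitary.mul_star_self_of_mem hU
  have hUU' : star U * U = 1 := Unitary.star_mul_self_of_mem hU
  have hP : IsStarProjection (spectralProjIic F t) := isStarProjection_starProjection
  have hE : IsStarProjection (star U * spectralProjIic F t * U) := by
    refine ⟨?_, hP.isSelfAdjoint.conjugate' U⟩
    have h := hP.isIdempotentElem
    rw [IsIdempotentElem] at h ⊢
    calc _ = star U * spectralProjIic F t * (U * star U) * spectralProjIic F t * U := by
          noncomm_ring
      _ = star U * (spectralProjIic F t * spectralProjIic F t) * U := by
          rw [hUU]; noncomm_ring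
      _ = _ := by rw [h]
  have hinv : ∀ x, star U (U x) = x := fun x => DFunLike.congr_fun hUU' x
  have hinv' : ∀ x, U (star U x) = x := fun x => DFunLike.congr_fun hUU x
  obtain ⟨h1, h2⟩ := isStarProjection_iff_eq_starProjection_range.1 hE
  rw [h2, spectralProjIic_eq]
  apply starProjection_congr
  have hmem : ∀ x, x ∈ lowerSubspace (star U * F * U) t ↔ U x ∈ lowerSubspace F t := by
    intro x
    change cfc (fun x : ℝ => max (x - t) 0) (star U * F * U) x = 0 ↔
      cfc (fun x : ℝ => max (x - t) 0) F (U x) = 0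
    rw [cfc_conj hF hU (by fun_prop)]
    simp only [mul_apply_eq_comp]
    refine ⟨fun h => ?_, fun h => by rw [h, map_zero]⟩
    rw [← hinv' (cfc _ F (U x)), h, map_zero]
  ext x
  rw [hmem]
  constructor
  · intro hx
    refine ⟨x, ?_⟩
    change star U (spectralProjIic F t (U x)) = x
    rw [spectralProjIic_eq, Submodule.starProjection_eq_self_iff.2 hx, hinv]
  · rintro ⟨y, rfl⟩
    change U (star U (spectralProjIic F t (U y))) ∈ _
    rw [hinv']
    exact Submodule.starProjection_apply_mem _ _

theorem finrank_range_spectralProj_conj {F U : H →L[ℂ] H} (hF : IsSelfAdjoint F)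
    (hU : U ∈ unitary (H →L[ℂ] H)) (a b : ℝ) :
    Module.finrank ℂ (spectralProj a b (star U * F * U)).range =
      Module.finrank ℂ (spectralProj a b F).range := by
  have hUU : U * star U = 1 := Unitary.mul_star_self_of_mem hU
  have hUU' : star U * U = 1 := Unitary.star_mul_self_of_mem hU
  have hinv : ∀ x, star U (U x) = x := fun x => DFunLike.congr_fun hUU' x
  have hinv' : ∀ x, U (star U x) = x := fun x => DFunLike.congr_fun hUU x
  have e : spectralProj a b (star U * F * U) = star U * spectralProj a b F * U := by
    rw [spectralProj, spectralProj, spectralProjIic_conj hF hU, spectralProjIic_conj hF hU]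
    noncomm_ring
  have hr : (spectralProj a b (star U * F * U)).range =
      (spectralProj a b F).range.map (star U).toLinearMap := by
    rw [e]
    ext x
    constructor
    · rintro ⟨y, rfl⟩
      exact ⟨_, ⟨U y, rfl⟩, rfl⟩
    · rintro ⟨_, ⟨y, rfl⟩, rfl⟩
      refine ⟨star U y, ?_⟩
      change star U (spectralProj a b F (U (star U y))) = _
      rw [hinv']
      rfl
  rw [hr]
  exact (Submodule.equivMapOfInjective (star U).toLinearMap
    (Function.LeftInverse.injective hinv') _).finrank_eq.symm

theorem SF_eq_relIndex_level (p : Pairs H) {c : ℝ} (hc0 : 0 < c) (hc1 : c < 1) : SF p =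
    relIndex (lowerSubspace p.1.1 c) (lowerSubspace (star p.1.2 * p.1.1 * p.1.2) c) := by
  have hK := (isCompactCLM_conj_sub p.2.2.1 p.2.2.2).neg
  rw [neg_sub] at hK
  rw [SF_eq_relIndex, relIndex_lowerSubspace_change_level p.2.1
    (conj_mem_SFHat p.2.1 p.2.2.1 p.2.2.2) hK hc0.le (by simp) ⟨by linarith, hc1⟩,
    finrank_range_spectralProj_conj (SFHat.isSelfAdjoint p.2.1) p.2.2.1, sub_self, add_zero]

theorem isLocallyConstant_SF : IsLocallyConstant (SF : Pairs H → ℤ) := by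
  rw [IsLocallyConstant.iff_eventually_eq]
  intro p
  have hzero : (0 : ℝ) ∈ Set.Ioo (-1 : ℝ) 1 := by simp
  have hmem : ∀ q : Pairs H, star q.1.2 * q.1.1 * q.1.2 ∈ SFHat H := fun q =>
    conj_mem_SFHat q.2.1 q.2.2.1 q.2.2.2
  have hK : ∀ q : Pairs H, IsCompactCLM (q.1.1 - star q.1.2 * q.1.1 * q.1.2) := fun q => by
    simpa using (isCompactCLM_conj_sub q.2.2.1 q.2.2.2).neg
  obtain ⟨c, d, hc, hcd, hd, hgap⟩ := SFHat.exists_hasGap p.2.1 hzero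
    (show (0 : ℝ) < 1 by norm_num)
  have hspec : spectrum ℝ (star p.1.2 * p.1.1 * p.1.2) = spectrum ℝ p.1.1 := by
    have := Unitary.spectrum_star_left_conjugate (R := ℝ) (a := p.1.1) (U := ⟨p.1.2, p.2.2.1⟩)
    exact this
  have hgap' : HasGap c d (star p.1.2 * p.1.1 * p.1.2) :=
    ⟨SFHat.isSelfAdjoint (hmem p), hspec ▸ hgap.2⟩
  have hcont : Continuous fun q : Pairs H => star q.1.2 * q.1.1 * q.1.2 := by fun_prop
  have h1 := continuousAt_spectralProjIic (γ := fun q : Pairs H => q.1.1) (x := p)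
    (by fun_prop) (fun q => SFHat.isSelfAdjoint q.2.1) hcd hgap
  have h2 := continuousAt_spectralProjIic (x := p) hcont.continuousAt
    (fun q => SFHat.isSelfAdjoint (hmem q)) hcd hgap'
  filter_upwards [Metric.tendsto_nhds.1 h1 1 one_pos, Metric.tendsto_nhds.1 h2 1 one_pos]
    with q hq1 hq2
  rw [dist_eq_norm] at hq1 hq2
  have hc' : c ∈ Set.Ioo (-1 : ℝ) 1 := ⟨by linarith, by linarith⟩
  rw [SF_eq_relIndex_level q hc hc'.2, SF_eq_relIndex_level p hc hc'.2]
  exact relIndex_eq_of_norm_sub_lt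
    (isCompactCLM_spectralProjIic_sub q.2.1 (hmem q) (hK q) hc')
    (isCompactCLM_spectralProjIic_sub p.2.1 (hmem p) (hK p) hc') hq1 hq2

end LocalConstancy

end PairFlow

end

/-- `SF` is a well-defined function on the space of pairs (each `Θ(F, U)` is non-empty and `SF(F, U)`
is the unique value of the spectral flow of every path in it), and it is locally constant. -/
theorem mainTheorem7 (H : Type*) [NormedAddCommGroup H] [InnerProductSpace ℂ H] [CompleteSpace H]
    [TopologicalSpace.SeparableSpace H] :
    (∀ p : PairFlow.Pairs H, (PairFlow.Theta p.1.1 p.1.2).Nonempty ∧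
      ∀ γ ∈ PairFlow.Theta p.1.1 p.1.2, ∀ m : ℤ,
        PairFlow.HasSpectralFlow γ m ↔ m = PairFlow.SF p) ∧
    IsLocallyConstant (PairFlow.SF : PairFlow.Pairs H → ℤ) := by
  refine ⟨fun p => ⟨PairFlow.Theta.nonempty p.2.1 p.2.2.1 p.2.2.2, fun γ hγ m => ?_⟩,
    PairFlow.isLocallyConstant_SF⟩
  rw [PairFlow.SF_eq_relIndex]
  exact PairFlow.hasSpectralFlow_iff hγ m
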